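/- **Theorem 1.6 (Different Gohberg–Kaashoek Numbers).** Let $\|\cdot\|$ be the spectral norm on $\mathbb{C}^{n\times n}$. For $A\in\mathbb{C}^{n\times n}$ and $\lambda\in\sigma(A)$ let $m_1(A,\lambda)\ge m_2(A,\lambda)\ge\dots\ge m_t(A,\lambda)$ be the sizes of the blocks for $\lambda$ in the Jordan form of $A$, put $m_i(A,\lambda)=0$ for $t<i\le n$, and call the numbers $m_i(A)=\sum_{\lambda\in\sigma(A)}m_i(A,\lambda)$, $i=1,\dots,n$, the Gohberg–Kaashoek numbers of $A$. A Schur decomposition of $A$ is a factorization $A=UTU^*$ with $U$ unitary and $T$ upper triangular. Fix $A_0\in\mathbb{C}^{n\times n}$ and a Schur decomposition $A_0=U_0T_0U_0^*$. For $\varepsilon>0$ let $\mathcal{D}_\varepsilon$ be the set of all $A\in\mathbb{C}^{n\times n}$ with $\|A-A_0\|<\varepsilon$ whose Gohberg–Kaashoek numbers are not all equal to those of $A_0$. There is $M>0$, independent of $\varepsilon$, such that the following hold. 1. For every $\varepsilon>0$ for which $\mathcal{D}_\varepsilon$ is non-empty, $$\sup_{A\in\mathcal{D}_\varepsilon}\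 \inf_{U,T}\ \bigl(\|U-U_0\|+\|T-T_0\|\bigr)>M,$$ where the infimum is taken over all Schur decompositions $A=UTU^*$. 2. If $A_0$ is derogatory, that is, $\dim\ker(A_0-\lambda I)\ge 2$ for some $\lambda\in\mathbb{C}$, then $\mathcal{D}_\varepsilon\neq\emptyset$ for every $\varepsilon>0$, and forward stability of the Schur form fails at $A_0=U_0T_0U_0^*$: there are no constants $K,\varepsilon>0$ such that every $A$ with $\|A-A_0\|<\varepsilon$ has a Schur decomposition $A=UTU^*$ with $\|U-U_0\|+\|T-T_0\|\le K\|A-A_0\|^{1/n}$. -/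

import Mathlib

open scoped Matrix.Norms.L2Operator

noncomputable section

namespace SchurStability

/-- The `k × k` upper Jordan block with eigenvalue `μ`: `μ` on the diagonal and `1` on the first
superdiagonal. -/
def jordanBlock (k : ℕ) (μ : ℂ) : Matrix (Fin k) (Fin k) ℂ :=
  Matrix.of fun i j => if i = j then μ else if (i : ℕ) + 1 = j then 1 else 0

/-- A Jordan form of the matrix `A`: finitely many Jordan blocks of positive size, indexed by
`Fin r`, whose block-diagonal sum (its rows and columns being numbered by `0, …, n - 1` through
`e`) is similar to `A`. -/
structure JordanForm {n : ℕ} (A : Matrix (Fin n) (Fin n) ℂ) where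
  /-- the number of blocks -/
  r : ℕ
  /-- the sizes of the blocks -/
  size : Fin r → ℕ
  size_pos : ∀ i, 0 < size i
  /-- the eigenvalues of the blocks -/
  eig : Fin r → ℂ
  /-- the numbering of the rows and columns -/
  e : Fin n ≃ (Σ i : Fin r, Fin (size i))
  /-- the matrix of the similarity -/
  P : (Matrix (Fin n) (Fin n) ℂ)ˣ
  eq_conj : A = P.1 *
    (Matrix.blockDiagonal' fun i => jordanBlock (size i) (eig i)).submatrix e e * (P⁻¹).1

/-- The multiset of the sizes of the blocks with eigenvalue `μ` in a Jordan form. -/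
def JordanForm.blockSizes {n : ℕ} {A : Matrix (Fin n) (Fin n) ℂ} (J : JordanForm A) (μ : ℂ) :
    Multiset ℕ :=
  (Finset.univ.filter fun i => J.eig i = μ).val.map J.size

/-- The number `m_{j+1}(A, μ)`: the `j`-th entry, counted from `0`, of the nonincreasing list of the
sizes of the blocks with eigenvalue `μ`, and `0` beyond the end of that list. -/
def JordanForm.partialMultiplicity {n : ℕ} {A : Matrix (Fin n) (Fin n) ℂ} (J : JordanForm A)
    (μ : ℂ) (j : ℕ) : ℕ :=
  ((J.blockSizes μ).sort (· ≥ ·)).getD j 0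

/-- The numbers `m_{j+1} = ∑_μ m_{j+1}(A, μ)` read off a Jordan form of `A`. The eigenvalues of `A`
are exactly the eigenvalues of the blocks. -/
def JordanForm.gk {n : ℕ} {A : Matrix (Fin n) (Fin n) ℂ} (J : JordanForm A) : Fin n → ℕ :=
  fun j => ∑ μ ∈ Finset.univ.image J.eig, J.partialMultiplicity μ j

open Classical in
/-- The Gohberg–Kaashoek numbers `(m_1(A), …, m_n(A))` of a complex `n × n` matrix, read off its
Jordan form (which exists, and is unique up to the order of the blocks). -/
def gkNumbers {n : ℕ} (A : Matrix (Fin n) (Fin n) ℂ) : Fin n → ℕ :=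
  if h : Nonempty (JordanForm A) then h.some.gk else 0

/-- `A = U T U*` is a Schur decomposition: `U` is unitary and `T` is upper triangular. -/
def IsSchurDecomposition {n : ℕ} (A U T : Matrix (Fin n) (Fin n) ℂ) : Prop :=
  U ∈ Matrix.unitaryGroup (Fin n) ℂ ∧ T.BlockTriangular id ∧ A = U * T * U.conjTranspose

/-- The matrices in the open `ε`-neighbourhood of `A₀` (in the spectral norm) whose
Gohberg–Kaashoek numbers differ from those of `A₀`. -/
def differentGK {n : ℕ} (A₀ : Matrix (Fin n) (Fin n) ℂ) (ε : ℝ) : Set (Matrix (Fin n) (Fin n) ℂ) :=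
  {A | ‖A - A₀‖ < ε ∧ gkNumbers A ≠ gkNumbers A₀}

/-- The infimum of `‖U - U₀‖ + ‖T - T₀‖` over all Schur decompositions `A = U T U*`. -/
def schurDist {n : ℕ} (U₀ T₀ A : Matrix (Fin n) (Fin n) ℂ) : ENNReal :=
  ⨅ (U : Matrix (Fin n) (Fin n) ℂ) (T : Matrix (Fin n) (Fin n) ℂ)
    (_ : IsSchurDecomposition A U T), ENNReal.ofReal (‖U - U₀‖ + ‖T - T₀‖)

/-- Some eigenspace of `A` has dimension at least two. -/
def IsDerogatory {n : ℕ} (A : Matrix (Fin n) (Fin n) ℂ) : Prop :=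
  ∃ μ : ℂ, 2 ≤ Module.finrank ℂ (Module.End.eigenspace (Matrix.toLin' A) μ)

/-- Forward stability of the Schur form at `A₀` with the decomposition `A₀ = U₀ T₀ U₀*`. -/
def ForwardStable {n : ℕ} (A₀ U₀ T₀ : Matrix (Fin n) (Fin n) ℂ) : Prop :=
  ∃ K > (0 : ℝ), ∃ ε > (0 : ℝ), ∀ A : Matrix (Fin n) (Fin n) ℂ, ‖A - A₀‖ < ε →
    ∃ U T : Matrix (Fin n) (Fin n) ℂ, IsSchurDecomposition A U T ∧
      ‖U - U₀‖ + ‖T - T₀‖ ≤ K * ‖A - A₀‖ ^ (1 / (n : ℝ))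

end SchurStability

end

noncomputable section

namespace SchurStability

open Filter Topology

variable {n : ℕ} {A : Matrix (Fin n) (Fin n) ℂ}

/-! Everything turns on whether `A₀` is derogatory, that is, whether two blocks of a Jordan form
share an eigenvalue (`JordanForm.isDerogatory_iff`). Non-derogatory matrices all have the numbers
(n, 0, …, 0), whereas derogatory ones have m₂ > 0. They form an open dense set
(`isClosed_isDerogatory`, `exists_not_isDerogatory`).

If `A₀` is not derogatory, a matrix with other numbers keeps a fixed distance from `A₀`, so by
continuity of (U, T) ↦ U T U* its Schur decompositions keep a fixed distance from (U₀, T₀).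

If `A₀` is derogatory with repeated eigenvalue c, let l be the eigenvector of T₀ for c with the
earliest last nonzero entry, at p say. Some block b has its first vector present in U₀ l. Gluing the
chain b to the end of another chain a for c, by an arbitrarily small perturbation, creates no new
eigenvalue and removes that first vector from the eigenspace of c. Were there Schur decompositions
(U, T) of such perturbations converging to (U₀, T₀), then T p p would eventually equal c, and unit
eigenvectors of T supported up to p would accumulate at a nonzero multiple of l, although their
b-coordinate is zero (`exists_notMem_schurBall`). Being far from (U₀, T₀) is an open condition, so
density yields a non-derogatory matrix with the same defect. -/

/-! ### Jordan coordinates and eigenvectors -/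

/-- The entry of `v` following the index `s` in its block, and `0` at the end of the block. -/
def nextEntry {r : ℕ} {size : Fin r → ℕ} (v : (Σ i : Fin r, Fin (size i)) → ℂ)
    (s : Σ i : Fin r, Fin (size i)) : ℂ :=
  if h : (s.2 : ℕ) + 1 < size s.1 then v ⟨s.1, ⟨s.2 + 1, h⟩⟩ else 0

theorem jordanBlock_mulVec {k : ℕ} (μ : ℂ) (v : Fin k → ℂ) (i : Fin k) :
    (jordanBlock k μ).mulVec v i =
      μ * v i + if h : (i : ℕ) + 1 < k then v ⟨i + 1, h⟩ else 0 := by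
  have h1 : ∀ j : Fin k, jordanBlock k μ i j * v j =
      (if i = j then μ * v j else 0) + (if (i : ℕ) + 1 = j then v j else 0) := by
    intro j
    simp only [jordanBlock, Matrix.of_apply]
    by_cases h : i = j
    · subst h; simp
    · simp [h]
  simp only [Matrix.mulVec, dotProduct, h1, Finset.sum_add_distrib]
  congr 1
  · simp
  · split_ifs with h
    · rw [Finset.sum_eq_single (⟨i + 1, h⟩ : Fin k)]
      · simp
      · intro j _ hj
        rw [if_neg]
        intro h'
        exact hj (Fin.ext h'.symm)
      · simp
    · apply Finset.sum_eq_zero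
      intro j _
      rw [if_neg]
      omega

theorem blockDiagonal_jordanBlock_mulVec {r : ℕ} (size : Fin r → ℕ) (eig : Fin r → ℂ)
    (v : (Σ i : Fin r, Fin (size i)) → ℂ) (s : Σ i : Fin r, Fin (size i)) :
    (Matrix.blockDiagonal' fun i => jordanBlock (size i) (eig i)).mulVec v s =
      eig s.1 * v s + nextEntry v s := by
  obtain ⟨i, k⟩ := s
  rw [nextEntry, ← jordanBlock_mulVec (eig i) (fun k => v ⟨i, k⟩) k]
  simp only [Matrix.mulVec, dotProduct, Fintype.sum_sigma]
  rw [Finset.sum_eq_single i]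
  · simp [Matrix.blockDiagonal'_apply]
  · intro j _ hj
    apply Finset.sum_eq_zero
    intro l _
    rw [Matrix.blockDiagonal'_apply_ne _ _ _ hj.symm, zero_mul]
  · simp

namespace JordanForm

/-- The coordinates of a vector in the Jordan basis. -/
def coords (J : JordanForm A) : (Fin n → ℂ) ≃ₗ[ℂ] ((Σ i : Fin J.r, Fin (J.size i)) → ℂ) :=
  (Matrix.toLin'OfInv (M := J.P.1) (M' := (J.P⁻¹).1) J.P.mul_inv J.P.inv_mul).trans
    (LinearEquiv.funCongrLeft ℂ ℂ J.e.symm)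

theorem coords_apply (J : JordanForm A) (u : Fin n → ℂ) (s : Σ i : Fin J.r, Fin (J.size i)) :
    J.coords u s = ((J.P⁻¹).1.mulVec u) (J.e.symm s) := by
  rfl

theorem coords_mulVec (J : JordanForm A) (u : Fin n → ℂ) (s : Σ i : Fin J.r, Fin (J.size i)) :
    J.coords (A.mulVec u) s = J.eig s.1 * J.coords u s + nextEntry (J.coords u) s := by
  rw [← blockDiagonal_jordanBlock_mulVec J.size J.eig]
  have h : (J.P⁻¹).1.mulVec (A.mulVec u) =
      ((Matrix.blockDiagonal' fun i => jordanBlock (J.size i) (J.eig i)).submatrix J.e J.e).mulVec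
        ((J.P⁻¹).1.mulVec u) := by
    have h1 : (J.P⁻¹).1 * A = ((Matrix.blockDiagonal' fun i =>
        jordanBlock (J.size i) (J.eig i)).submatrix J.e J.e) * (J.P⁻¹).1 := by
      have := congrArg ((J.P⁻¹).1 * ·) J.eq_conj
      simpa only [← Matrix.mul_assoc, J.P.inv_mul, Matrix.one_mul] using this
    rw [Matrix.mulVec_mulVec, h1, Matrix.mulVec_mulVec]
  rw [coords_apply, h]
  rw [Matrix.submatrix_mulVec_equiv]
  simp only [Function.comp_apply, Equiv.apply_symm_apply]
  congr 1

/-- The solutions of the homogeneous equation for one Jordan block. -/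
theorem eq_zero_of_block {r : ℕ} {size : Fin r → ℕ} {v : (Σ i : Fin r, Fin (size i)) → ℂ}
    {c : ℂ} {i : Fin r} (hc : c ≠ 0)
    (h : ∀ k : Fin (size i), c * v ⟨i, k⟩ + nextEntry v ⟨i, k⟩ = 0) (k : Fin (size i)) :
    v ⟨i, k⟩ = 0 := by
  obtain ⟨k, hk⟩ := k
  -- Back substitution, starting at the last entry of the block.
  induction hm : size i - k generalizing k with
  | zero => omega
  | succ m ih =>
    have h1 := h ⟨k, hk⟩
    have h2 : nextEntry v ⟨i, ⟨k, hk⟩⟩ = 0 := by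
      unfold nextEntry
      split_ifs with h'
      · exact ih (k + 1) h' (by omega)
      · rfl
    rw [h2, add_zero] at h1
    exact (mul_eq_zero.mp h1).resolve_left hc

theorem eq_zero_of_nextEntry_eq_zero {r : ℕ} {size : Fin r → ℕ}
    {v : (Σ i : Fin r, Fin (size i)) → ℂ} {i : Fin r}
    (h : ∀ k : Fin (size i), nextEntry v ⟨i, k⟩ = 0) (k : Fin (size i)) (hk : 0 < (k : ℕ)) :
    v ⟨i, k⟩ = 0 := by
  obtain ⟨k, hk'⟩ := k
  obtain ⟨m, rfl⟩ : ∃ m, k = m + 1 := ⟨k - 1, by simp only at hk; omega⟩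
  have h1 := h ⟨m, by omega⟩
  rwa [nextEntry, dif_pos hk'] at h1

theorem coords_eq_of_eigenvector (J : JordanForm A) {u : Fin n → ℂ} {μ : ℂ}
    (hu : A.mulVec u = μ • u) (s : Σ i : Fin J.r, Fin (J.size i)) :
    (J.eig s.1 - μ) * J.coords u s + nextEntry (J.coords u) s = 0 := by
  have h := J.coords_mulVec u s
  rw [hu, map_smul, Pi.smul_apply, smul_eq_mul] at h
  linear_combination -h

/-- An eigenvector lives on the first entries of the blocks of its eigenvalue. -/
theorem coords_eq_zero_of_eigenvector (J : JordanForm A) {u : Fin n → ℂ} {μ : ℂ}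
    (hu : A.mulVec u = μ • u) (s : Σ i : Fin J.r, Fin (J.size i))
    (hs : J.eig s.1 ≠ μ ∨ 0 < (s.2 : ℕ)) : J.coords u s = 0 := by
  obtain ⟨i, k⟩ := s
  have h := fun k => J.coords_eq_of_eigenvector hu ⟨i, k⟩
  by_cases hi : J.eig i = μ
  · simp only [hi, sub_self, zero_mul, zero_add, ne_eq, not_true_eq_false, false_or] at h hs
    exact eq_zero_of_nextEntry_eq_zero h k hs
  · exact eq_zero_of_block (sub_ne_zero.mpr hi) h k

/-- The first index of a block. -/
def bot (J : JordanForm A) (i : Fin J.r) : Σ i : Fin J.r, Fin (J.size i) :=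
  ⟨i, ⟨0, J.size_pos i⟩⟩

/-- The last index of a block. -/
def top (J : JordanForm A) (i : Fin J.r) : Σ i : Fin J.r, Fin (J.size i) :=
  ⟨i, ⟨J.size i - 1, Nat.sub_lt (J.size_pos i) one_pos⟩⟩

theorem eq_bot_or (J : JordanForm A) (s : Σ i : Fin J.r, Fin (J.size i)) :
    s = J.bot s.1 ∨ 0 < (s.2 : ℕ) := by
  obtain ⟨i, k, hk⟩ := s
  rcases Nat.eq_zero_or_pos k with h | h
  · subst h; exact Or.inl rfl
  · exact Or.inr h

/-- The eigenvector at the start of a Jordan chain. -/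
def botVec (J : JordanForm A) (i : Fin J.r) : Fin n → ℂ := J.coords.symm (Pi.single (J.bot i) 1)

theorem mulVec_botVec (J : JordanForm A) (i : Fin J.r) :
    A.mulVec (J.botVec i) = J.eig i • J.botVec i := by
  apply J.coords.injective
  ext s
  rw [coords_mulVec, map_smul, Pi.smul_apply, smul_eq_mul, botVec, LinearEquiv.apply_symm_apply]
  have h1 : nextEntry (Pi.single (J.bot i) (1 : ℂ)) s = 0 := by
    unfold nextEntry
    split_ifs with h
    · apply Pi.single_eq_of_ne
      intro h'
      have := congrArg (fun s => (s.2 : ℕ)) h'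
      simp [bot] at this
    · rfl
  rw [h1, add_zero]
  by_cases hs : s = J.bot i
  · subst hs; rfl
  · rw [Pi.single_eq_of_ne hs]; simp

end JordanForm

theorem isDerogatory_iff : IsDerogatory A ↔ ∃ (μ : ℂ) (u v : Fin n → ℂ),
    LinearIndependent ℂ ![u, v] ∧ A.mulVec u = μ • u ∧ A.mulVec v = μ • v := by
  constructor
  · rintro ⟨μ, h⟩
    obtain ⟨f, hf⟩ := exists_linearIndependent_of_le_finrank h
    refine ⟨μ, f 0, f 1, ?_, ?_, ?_⟩
    · have := hf.map' (Submodule.subtype _) (Submodule.ker_subtype _)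
      have h2 : ![(f 0 : Fin n → ℂ), f 1] = Submodule.subtype _ ∘ f := by
        ext i; fin_cases i <;> rfl
      rw [h2]; exact this
    · simpa using Module.End.mem_eigenspace_iff.mp (f 0).2
    · simpa using Module.End.mem_eigenspace_iff.mp (f 1).2
  · rintro ⟨μ, u, v, h, hu, hv⟩
    refine ⟨μ, ?_⟩
    have hmem : ∀ i, ![u, v] i ∈ Module.End.eigenspace (Matrix.toLin' A) μ := by
      intro i
      rw [Module.End.mem_eigenspace_iff]
      fin_cases i
      · simpa using hu
      · simpa using hv
    have h2 : LinearIndependent ℂ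
        (fun i => (⟨![u, v] i, hmem i⟩ : Module.End.eigenspace (Matrix.toLin' A) μ)) :=
      LinearIndependent.of_comp (Submodule.subtype _) h
    simpa using h2.fintype_card_le_finrank

/-- Eigenvectors live on first entries of blocks of their eigenvalue: a single such block leaves
only a line, and two such blocks give independent starting vectors. -/
theorem JordanForm.isDerogatory_iff (J : JordanForm A) :
    IsDerogatory A ↔ ¬ Function.Injective J.eig := by
  rw [SchurStability.isDerogatory_iff]
  constructor
  · rintro ⟨μ, u, v, h, hu, hv⟩ hinj
    rw [LinearIndependent.pair_iff] at h
    have hu0 : u ≠ 0 := by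
      rintro rfl
      simpa using h 1 0 (by simp)
    have : J.coords u ≠ 0 := by simpa using hu0
    obtain ⟨s, hs⟩ := Function.ne_iff.mp this
    have hs1 : J.eig s.1 = μ := by
      by_contra hne
      exact hs (J.coords_eq_zero_of_eigenvector hu s (Or.inl hne))
    have key : J.coords v s • u + (-J.coords u s) • v = 0 := by
      apply J.coords.injective
      ext s'
      simp only [map_add, map_smul, Pi.add_apply, Pi.smul_apply, smul_eq_mul, map_zero,
        Pi.zero_apply]
      by_cases hs' : s' = s
      · subst hs'; ring
      · have hz : J.eig s'.1 ≠ μ ∨ 0 < (s'.2 : ℕ) := by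
          by_contra! hcon
          apply hs'
          have h1 := hinj (hs1.trans hcon.1.symm)
          rcases J.eq_bot_or s' with h2 | h2
          · rcases J.eq_bot_or s with h3 | h3
            · rw [h2, h3, h1]
            · exact absurd (J.coords_eq_zero_of_eigenvector hu s (Or.inr h3)) hs
          · omega
        rw [J.coords_eq_zero_of_eigenvector hu s' hz, J.coords_eq_zero_of_eigenvector hv s' hz]
        ring
    have := (h _ _ key).2
    exact hs (by simpa using this)
  · intro h
    simp only [Function.Injective, not_forall] at h
    obtain ⟨i, j, hij, hne⟩ := h
    refine ⟨J.eig i, J.botVec i, J.botVec j, ?_, J.mulVec_botVec i, ?_⟩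
    · rw [LinearIndependent.pair_iff]
      intro s t hst
      have hb : J.bot i ≠ J.bot j := fun h' => hne (congrArg Sigma.fst h')
      have h1 := congrFun (congrArg J.coords hst)
      simp only [map_add, map_smul, JordanForm.botVec, LinearEquiv.apply_symm_apply, Pi.add_apply,
        Pi.smul_apply, smul_eq_mul, map_zero, Pi.zero_apply] at h1
      constructor
      · have := h1 (J.bot i)
        rw [Pi.single_eq_same, Pi.single_eq_of_ne hb] at this
        simpa using this
      · have := h1 (J.bot j)
        rw [Pi.single_eq_same, Pi.single_eq_of_ne hb.symm] at this
        simpa using this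
    · rw [hij]; exact J.mulVec_botVec j

/-! ### Existence of the Jordan form -/

section JordanExistence

open Polynomial

/-- A basis consisting of Jordan chains gives a Jordan form. -/
theorem JordanForm.nonempty_of_basis {r : ℕ} (size : Fin r → ℕ) (size_pos : ∀ i, 0 < size i)
    (eig : Fin r → ℂ) (b : Module.Basis (Σ i : Fin r, Fin (size i)) ℂ (Fin n → ℂ))
    (hb : ∀ i k, A.mulVec (b ⟨i, k⟩) = eig i • b ⟨i, k⟩ +
      if h : 0 < (k : ℕ) then b ⟨i, ⟨k - 1, by omega⟩⟩ else 0) :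
    Nonempty (JordanForm A) := by
  have hcard : Fintype.card (Fin n) = Fintype.card (Σ i : Fin r, Fin (size i)) := by
    rw [← Module.finrank_eq_card_basis b]; simp
  let e := Fintype.equivOfCardEq hcard
  let b' := b.reindex e.symm
  let P : (Matrix (Fin n) (Fin n) ℂ)ˣ :=
    ⟨(Pi.basisFun ℂ (Fin n)).toMatrix b', b'.toMatrix (Pi.basisFun ℂ (Fin n)),
      Module.Basis.toMatrix_mul_toMatrix_flip _ _, Module.Basis.toMatrix_mul_toMatrix_flip _ _⟩
  have hP : ∀ i s, P.1 i (e.symm s) = b s i := by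
    intro i s
    simp [P, b', Module.Basis.toMatrix_apply]
  refine ⟨⟨r, size, size_pos, eig, e, P, ?_⟩⟩
  -- In the form A P = P J the identity is checked column by column.
  rw [← Units.mul_inv_eq_iff_eq_mul, inv_inv]
  ext i j
  obtain ⟨⟨l, k⟩, rfl⟩ := e.symm.surjective j
  have h1 : (A * P.1) i (e.symm ⟨l, k⟩) = A.mulVec (b ⟨l, k⟩) i := by
    simp only [Matrix.mul_apply, Matrix.mulVec, dotProduct, hP]
  rw [h1, hb, Matrix.mul_apply, ← e.symm.sum_comp]
  simp only [hP, Matrix.submatrix_apply, Equiv.apply_symm_apply, Fintype.sum_sigma, Pi.add_apply,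
    Pi.smul_apply, smul_eq_mul]
  rw [Finset.sum_eq_single l]
  · simp only [Matrix.blockDiagonal'_apply_eq, jordanBlock, Matrix.of_apply]
    have h2 : ∀ x : Fin (size l), (b ⟨l, x⟩ i * if x = k then eig l else
        if (x : ℕ) + 1 = k then 1 else 0) = (if x = k then eig l * b ⟨l, x⟩ i else 0) +
        if (x : ℕ) + 1 = k then b ⟨l, x⟩ i else 0 := by
      intro x
      by_cases h : x = k
      · subst h; simp [mul_comm]
      · simp [h]
    simp only [h2, Finset.sum_add_distrib]
    congr 1
    · simp
    · split_ifs with h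
      · rw [Finset.sum_eq_single (⟨k - 1, by omega⟩ : Fin (size l))]
        · rw [if_pos (by simp only; omega)]
        · intro x _ hx
          rw [if_neg]
          intro h'
          apply hx
          apply Fin.ext
          simp only
          omega
        · simp
      · symm
        apply Finset.sum_eq_zero
        intro x _
        rw [if_neg]
        omega
  · intro m _ hm
    apply Finset.sum_eq_zero
    intro x _
    rw [Matrix.blockDiagonal'_apply_ne _ _ _ hm, mul_zero]
  · simp

/-- The powers `(X - μ) ^ (e - 1 - k)`, `k < e`, form a basis of `ℂ[X] ⧸ (X - μ) ^ e`. -/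
theorem exists_basis_quotient_pow (μ : ℂ) (e : ℕ) (I : Submodule ℂ[X] ℂ[X])
    (hI : I = ℂ[X] ∙ (X - C μ) ^ e) :
    ∃ b : Module.Basis (Fin e) ℂ (ℂ[X] ⧸ I),
      ∀ k, b k = Submodule.Quotient.mk ((X - C μ) ^ (e - 1 - k)) := by
  subst hI
  have hm : ((X - C μ) ^ e).Monic := (monic_X_sub_C μ).pow e
  have hfr : Module.finrank ℂ (ℂ[X] ⧸ (ℂ[X] ∙ (X - C μ) ^ e)) = e := by
    have := (AdjoinRoot.powerBasis' hm).finrank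
    rw [AdjoinRoot.powerBasis'_dim, natDegree_pow, natDegree_X_sub_C, mul_one] at this
    exact this
  have hspan : ⊤ ≤ Submodule.span ℂ (Set.range fun k : Fin e =>
      (Submodule.Quotient.mk ((X - C μ) ^ (e - 1 - k)) :
        ℂ[X] ⧸ (ℂ[X] ∙ (X - C μ) ^ e))) := by
    rintro x -
    obtain ⟨p, rfl⟩ := Submodule.Quotient.mk_surjective _ x
    -- Taylor expansion at `μ`: the terms of degree at least `e` vanish in the quotient.
    rw [← sum_taylor_eq p μ, Polynomial.sum, ← Submodule.mkQ_apply, map_sum]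
    refine Submodule.sum_mem _ fun i _ => ?_
    rw [← smul_eq_C_mul, Submodule.mkQ_apply, Submodule.Quotient.mk_smul]
    refine Submodule.smul_mem _ _ ?_
    by_cases hi : i < e
    · refine Submodule.subset_span ⟨⟨e - 1 - i, by omega⟩, ?_⟩
      simp only
      congr 2
      omega
    · rw [(Submodule.Quotient.mk_eq_zero _).mpr]
      · exact Submodule.zero_mem _
      · exact Ideal.mem_span_singleton.mpr (pow_dvd_pow _ (by omega))
  exact ⟨basisOfTopLeSpanOfCardEqFinrank _ hspan (by simp [hfr]), fun k => by simp⟩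

/-- Multiplication by `X` on the powers of `X - μ` modulo `(X - μ) ^ e`. -/
theorem X_smul_mk_pow (μ : ℂ) (e : ℕ) (I : Submodule ℂ[X] ℂ[X])
    (hI : I = ℂ[X] ∙ (X - C μ) ^ e) (k : Fin e) :
    (X : ℂ[X]) • (Submodule.Quotient.mk ((X - C μ) ^ (e - 1 - k)) : ℂ[X] ⧸ I) =
      μ • Submodule.Quotient.mk ((X - C μ) ^ (e - 1 - k)) +
        if 0 < (k : ℕ) then Submodule.Quotient.mk ((X - C μ) ^ (e - 1 - (k - 1))) else 0 := by
  have h1 : (X : ℂ[X]) • (X - C μ) ^ (e - 1 - k) =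
      μ • (X - C μ) ^ (e - 1 - k) + (X - C μ) ^ (e - 1 - k + 1) := by
    rw [smul_eq_mul, smul_eq_C_mul]; ring
  rw [← Submodule.Quotient.mk_smul, h1, Submodule.Quotient.mk_add, Submodule.Quotient.mk_smul]
  congr 1
  split_ifs with h
  · congr 2
    omega
  · rw [Submodule.Quotient.mk_eq_zero, hI]
    exact Ideal.mem_span_singleton.mpr (pow_dvd_pow _ (by omega))

/-- With X acting as `A`, ℂⁿ is a finitely generated torsion module over the principal ideal domain
ℂ[X], hence a sum of quotients by powers of irreducibles, which are linear over ℂ. -/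
theorem JordanForm.exists (A : Matrix (Fin n) (Fin n) ℂ) : Nonempty (JordanForm A) := by
  classical
  let f := Matrix.toLin' A
  have htor : Module.IsTorsion ℂ[X] (Module.AEval' f) :=
    Module.AEval.isTorsion_of_finiteDimensional ℂ (Fin n → ℂ) f
  obtain ⟨ι, _, p, hp, e, ⟨Φ⟩⟩ := Module.equiv_directSum_of_isTorsion htor
  have hassoc : ∀ i, ∃ μ : ℂ, Associated (p i) (X - C μ) := by
    intro i
    have hd := IsAlgClosed.degree_eq_one_of_irreducible ℂ (hp i)
    obtain ⟨μ, hμ⟩ := exists_root_of_degree_eq_one hd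
    exact ⟨μ, ((irreducible_X_sub_C μ).associated_of_dvd (hp i) (dvd_iff_isRoot.mpr hμ)).symm⟩
  choose μ hμ using hassoc
  have hspan : ∀ i, (ℂ[X] ∙ p i ^ e i) = (ℂ[X] ∙ (X - C (μ i)) ^ e i) := fun i =>
    Ideal.span_singleton_eq_span_singleton.mpr ((hμ i).pow_pow)
  choose b hb using fun i => exists_basis_quotient_pow (μ i) (e i) _ (hspan i)
  let Ψ := (Φ.restrictScalars ℂ).symm.trans (Module.AEval'.of f).symm
  have hΨ : ∀ w, A.mulVec (Ψ w) = Ψ ((X : ℂ[X]) • w) := by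
    intro w
    have h1 : Ψ ((X : ℂ[X]) • w) =
        (Module.AEval'.of f).symm ((X : ℂ[X]) • Φ.symm w) := by
      rw [← Φ.symm.map_smul]; rfl
    rw [h1, Module.AEval'.of_symm_X_smul]
    rfl
  let B := (DFinsupp.basis b).map Ψ
  have hB : ∀ i k, B ⟨i, k⟩ = Ψ (DFinsupp.single i (b i k)) := by
    intro i k
    simp [B, DFinsupp.basis]
  have hact : ∀ i (k : Fin (e i)), A.mulVec (B ⟨i, k⟩) = μ i • B ⟨i, k⟩ +
      if h : 0 < (k : ℕ) then B ⟨i, ⟨k - 1, by omega⟩⟩ else 0 := by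
    intro i k
    have h1 : (X : ℂ[X]) • (DFinsupp.single i (b i k) :
        Π₀ i, ℂ[X] ⧸ (ℂ[X] ∙ p i ^ e i)) = μ i • DFinsupp.single i (b i k) +
        DFinsupp.single i (if h : 0 < (k : ℕ) then b i ⟨k - 1, by omega⟩ else 0) := by
      rw [← DFinsupp.single_smul, ← DFinsupp.single_smul, ← DFinsupp.single_add, hb,
        X_smul_mk_pow _ _ _ (hspan i)]
      congr 2
      split_ifs
      · rw [hb]
      · rfl
    rw [hB, hΨ]
    refine (congrArg Ψ h1).trans ?_
    rw [map_add, map_smul]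
    congr 1
    split_ifs
    · rw [hB]
    · rw [DFinsupp.single_zero, map_zero]
  -- The structure theorem allows exponents 0; these zero summands are dropped, since blocks have
  -- positive size.
  let g := (Fintype.equivFin {i // 0 < e i}).symm
  let σ : (Σ i : Fin (Fintype.card {i // 0 < e i}), Fin (e (g i))) ≃ Σ i, Fin (e i) :=
    (Equiv.sigmaCongrLeft (β := fun i : {i // 0 < e i} => Fin (e i)) g).trans
      (Equiv.ofBijective (fun s => ⟨s.1, s.2⟩) ⟨by
        rintro ⟨⟨i, hi⟩, k⟩ ⟨⟨j, hj⟩, l⟩ h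
        simp only [Sigma.mk.injEq] at h
        obtain ⟨rfl, h⟩ := h
        rw [eq_of_heq h], fun ⟨i, k⟩ => ⟨⟨⟨i, Fin.pos k⟩, k⟩, rfl⟩⟩)
  refine JordanForm.nonempty_of_basis (fun i => e (g i)) (fun i => (g i).2) (fun i => μ (g i))
    (B.reindex σ.symm) fun i k => ?_
  simp only [Module.Basis.reindex_apply, Equiv.symm_symm]
  exact hact (g i) k

end JordanExistence

/-! ### Gohberg–Kaashoek numbers and derogatory matrices -/

namespace JordanForm

theorem sum_size (J : JordanForm A) : ∑ i, J.size i = n := by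
  have := Fintype.card_congr J.e
  simpa using this.symm

theorem blockSizes_of_injective (J : JordanForm A) (h : Function.Injective J.eig) (i : Fin J.r) :
    J.blockSizes (J.eig i) = {J.size i} := by
  have : (Finset.univ.filter fun k => J.eig k = J.eig i) = {i} := by
    ext k
    simp [h.eq_iff]
  rw [blockSizes, this]
  simp

theorem gk_of_injective (J : JordanForm A) (h : Function.Injective J.eig) (j : Fin n) :
    J.gk j = if (j : ℕ) = 0 then n else 0 := by
  have h1 : ∀ i, J.partialMultiplicity (J.eig i) j = if (j : ℕ) = 0 then J.size i else 0 := by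
    intro i
    rw [partialMultiplicity, J.blockSizes_of_injective h, Multiset.sort_singleton]
    rcases Nat.eq_zero_or_pos (j : ℕ) with hj | hj
    · simp [hj]
    · rw [if_neg hj.ne', List.getD_eq_default]
      simpa [Nat.one_le_iff_ne_zero, Nat.pos_iff_ne_zero] using hj
  rw [gk, Finset.sum_image h.injOn]
  simp only [h1]
  split_ifs
  · exact J.sum_size
  · simp

theorem gk_one_pos (J : JordanForm A) (h : ¬ Function.Injective J.eig) (hn : 1 < n) :
    0 < J.gk ⟨1, hn⟩ := by
  simp only [Function.Injective, not_forall] at h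
  obtain ⟨i, j, hij, hne⟩ := h
  have hcard : 1 < (J.blockSizes (J.eig i)).card := by
    rw [blockSizes, Multiset.card_map]
    exact Finset.one_lt_card.mpr ⟨i, by simp, j, by simp [hij], hne⟩
  have hlen : 1 < ((J.blockSizes (J.eig i)).sort (· ≥ ·)).length := by
    rwa [Multiset.length_sort]
  have hpos : 0 < J.partialMultiplicity (J.eig i) 1 := by
    rw [partialMultiplicity, List.getD_eq_getElem _ _ hlen]
    have hmem := List.getElem_mem hlen
    obtain ⟨k, -, hk⟩ := Multiset.mem_map.mp ((Multiset.mem_sort _).mp hmem)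
    rw [← hk]
    exact J.size_pos k
  rw [gk]
  exact hpos.trans_le (Finset.single_le_sum (f := fun μ => J.partialMultiplicity μ 1)
    (fun _ _ => Nat.zero_le _) (Finset.mem_image_of_mem _ (Finset.mem_univ i)))

end JordanForm

/-- Uniqueness of the Jordan form is not needed: whichever form is chosen, its blocks have distinct
eigenvalues. -/
theorem gkNumbers_of_not_isDerogatory (h : ¬ IsDerogatory A) :
    gkNumbers A = fun j : Fin n => if (j : ℕ) = 0 then n else 0 := by
  have hJ := JordanForm.exists A
  rw [gkNumbers, dif_pos hJ]
  ext j
  exact JordanForm.gk_of_injective _ (not_not.mp (hJ.some.isDerogatory_iff.not.mp h)) j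

theorem IsDerogatory.one_lt (h : IsDerogatory A) : 1 < n := by
  obtain ⟨μ, h⟩ := h
  have := h.trans (Submodule.finrank_le _)
  rw [Module.finrank_fin_fun] at this
  exact this

theorem gkNumbers_ne (hA : IsDerogatory A) {B : Matrix (Fin n) (Fin n) ℂ}
    (hB : ¬ IsDerogatory B) : gkNumbers B ≠ gkNumbers A := by
  have hJ := JordanForm.exists A
  intro h
  have h1 := congrFun h ⟨1, hA.one_lt⟩
  rw [gkNumbers_of_not_isDerogatory hB, gkNumbers, dif_pos hJ] at h1
  have h2 := hJ.some.gk_one_pos (hJ.some.isDerogatory_iff.mp hA) hA.one_lt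
  simp only [one_ne_zero, if_false] at h1
  omega

/-! ### Non-derogatory matrices are open and dense -/

open scoped ComplexOrder in
/-- Derogatory matrices, by equations in two orthogonal unit vectors that are polynomial in the
matrix and the vectors. -/
theorem isDerogatory_iff_exists_unit : IsDerogatory A ↔
    ∃ u v : Metric.sphere (0 : Fin n → ℂ) 1, star u.1 ⬝ᵥ v.1 = 0 ∧
      (star u.1 ⬝ᵥ u.1) • A.mulVec u = (star u.1 ⬝ᵥ A.mulVec u) • u.1 ∧
      (star u.1 ⬝ᵥ u.1) • A.mulVec v = (star u.1 ⬝ᵥ A.mulVec u) • v.1 := by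
  have normalize : ∀ w : Fin n → ℂ, w ≠ 0 → ∃ w' : Metric.sphere (0 : Fin n → ℂ) 1,
      ∃ c : ℂ, w'.1 = c • w := by
    intro w hw
    refine ⟨⟨((‖w‖⁻¹ : ℝ) : ℂ) • w, ?_⟩, _, rfl⟩
    rw [mem_sphere_zero_iff_norm, norm_smul, Complex.norm_real, norm_inv, norm_norm,
      inv_mul_cancel₀ (norm_ne_zero_iff.mpr hw)]
  have ne_zero : ∀ w : Metric.sphere (0 : Fin n → ℂ) 1, w.1 ≠ 0 := fun w =>
    ne_zero_of_mem_unit_sphere w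
  rw [isDerogatory_iff]
  constructor
  · rintro ⟨μ, u, v, h, hu, hv⟩
    rw [LinearIndependent.pair_iff] at h
    have hu0 : u ≠ 0 := by
      rintro rfl
      simpa using h 1 0 (by simp)
    obtain ⟨u', c, hc⟩ := normalize u hu0
    have hu' : A.mulVec u' = μ • u'.1 := by
      rw [hc, Matrix.mulVec_smul, hu, smul_comm]
    have huu : star u'.1 ⬝ᵥ u'.1 ≠ 0 := by
      rw [ne_eq, dotProduct_star_self_eq_zero]
      exact ne_zero u'
    -- Gram–Schmidt. The sphere is that of the sup norm, so the division by `star u' ⬝ᵥ u'` cannot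
    -- be omitted.
    set w := v - ((star u'.1 ⬝ᵥ v) / (star u'.1 ⬝ᵥ u'.1)) • u'.1 with hw
    have hw0 : w ≠ 0 := by
      intro h0
      have h1 : v = ((star u'.1 ⬝ᵥ v) / (star u'.1 ⬝ᵥ u'.1)) • c • u := by
        rw [← hc]; exact sub_eq_zero.mp h0
      generalize (star u'.1 ⬝ᵥ v) / (star u'.1 ⬝ᵥ u'.1) = q at h1
      have := (h (-(q * c)) 1 (by rw [h1]; module)).2
      exact one_ne_zero this
    have hwA : A.mulVec w = μ • w := by
      rw [hw, Matrix.mulVec_sub, Matrix.mulVec_smul, hv, hu']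
      module
    have hwu : star u'.1 ⬝ᵥ w = 0 := by
      rw [hw, dotProduct_sub, dotProduct_smul, smul_eq_mul, div_mul_cancel₀ _ huu, sub_self]
    obtain ⟨v', d, hd⟩ := normalize w hw0
    refine ⟨u', v', ?_, ?_, ?_⟩
    · rw [hd, dotProduct_smul, hwu, smul_zero]
    · rw [hu', dotProduct_smul, smul_smul, smul_eq_mul, mul_comm]
    · rw [hu', hd, Matrix.mulVec_smul, hwA, dotProduct_smul, smul_eq_mul]
      module
  · rintro ⟨u, v, huv, hu, hv⟩
    have huu : star u.1 ⬝ᵥ u.1 ≠ 0 := by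
      rw [ne_eq, dotProduct_star_self_eq_zero]
      exact ne_zero u
    refine ⟨(star u.1 ⬝ᵥ A.mulVec u) / (star u.1 ⬝ᵥ u.1), u, v, ?_, ?_, ?_⟩
    · rw [LinearIndependent.pair_iff]
      intro s t hst
      have h1 := congrArg (star u.1 ⬝ᵥ ·) hst
      simp only [dotProduct_add, dotProduct_smul, huv, smul_eq_mul, mul_zero, add_zero,
        dotProduct_zero, mul_eq_zero, huu, or_false] at h1
      subst h1
      rw [zero_smul, zero_add] at hst
      exact ⟨rfl, (smul_eq_zero.mp hst).resolve_right (ne_zero v)⟩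
    · rw [div_eq_inv_mul, mul_smul, ← hu, smul_smul, inv_mul_cancel₀ huu, one_smul]
    · rw [div_eq_inv_mul, mul_smul, ← hv, smul_smul, inv_mul_cancel₀ huu, one_smul]

/-- The set is the projection of a closed set along the compact factor of pairs of unit vectors. -/
theorem isClosed_isDerogatory : IsClosed {A : Matrix (Fin n) (Fin n) ℂ | IsDerogatory A} := by
  let S := Metric.sphere (0 : Fin n → ℂ) 1
  let K : Set (Matrix (Fin n) (Fin n) ℂ × (S × S)) := {x | star x.2.1.1 ⬝ᵥ x.2.2.1 = 0 ∧
    (star x.2.1.1 ⬝ᵥ x.2.1.1) • x.1.mulVec x.2.1 = (star x.2.1.1 ⬝ᵥ x.1.mulVec x.2.1) • x.2.1.1 ∧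
    (star x.2.1.1 ⬝ᵥ x.2.1.1) • x.1.mulVec x.2.2 = (star x.2.1.1 ⬝ᵥ x.1.mulVec x.2.1) • x.2.2.1}
  have hK : IsClosed K := by
    refine (isClosed_eq ?_ ?_).inter ((isClosed_eq ?_ ?_).inter (isClosed_eq ?_ ?_)) <;> fun_prop
  have h := isClosedMap_fst_of_compactSpace (X := Matrix (Fin n) (Fin n) ℂ) (Y := S × S) K hK
  convert h using 1
  ext A
  rw [Set.mem_ofPred_eq, isDerogatory_iff_exists_unit]
  constructor
  · rintro ⟨u, v, h⟩
    exact ⟨(A, u, v), h, rfl⟩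
  · rintro ⟨⟨_, u, v⟩, h, rfl⟩
    exact ⟨u, v, h⟩

/-- Matrices that are not derogatory are dense. -/
theorem exists_not_isDerogatory (A : Matrix (Fin n) (Fin n) ℂ) {ε : ℝ} (hε : 0 < ε) :
    ∃ B, ‖B - A‖ < ε ∧ ¬ IsDerogatory B := by
  obtain ⟨J⟩ := JordanForm.exists A
  -- Shifting block `i` by `s * i` separates all block eigenvalues for small nonzero `s`.
  let eig : ℂ → Fin J.r → ℂ := fun s i => J.eig i + s * (i : ℕ)
  let B : ℂ → Matrix (Fin n) (Fin n) ℂ := fun s => J.P.1 *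
    (Matrix.blockDiagonal' fun i => jordanBlock (J.size i) (eig s i)).submatrix J.e J.e *
      (J.P⁻¹).1
  have hB0 : B 0 = A := by
    conv_rhs => rw [J.eq_conj]
    simp [B, eig]
  have hBc : Continuous B := by
    refine (Continuous.matrix_mul continuous_const (Continuous.matrix_submatrix
      (Continuous.matrix_blockDiagonal' ?_) _ _)).matrix_mul continuous_const
    refine continuous_pi fun i => continuous_matrix fun k l => ?_
    simp only [jordanBlock, Matrix.of_apply, eig]
    split_ifs <;> fun_prop
  have h1 : ∀ᶠ s in nhdsWithin (0 : ℂ) {0}ᶜ, ‖B s - A‖ < ε := by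
    apply Filter.Eventually.filter_mono nhdsWithin_le_nhds
    have : Continuous fun s => ‖B s - A‖ := by fun_prop
    exact this.continuousAt.eventually_lt continuousAt_const (by simpa [hB0] using hε)
  have h2 : ∀ᶠ s in nhdsWithin (0 : ℂ) {0}ᶜ, ∀ i j, i ≠ j → eig s i ≠ eig s j := by
    rw [Filter.eventually_all]; intro i
    rw [Filter.eventually_all]; intro j
    by_cases hij : i = j
    · simp [hij]
    have hd : ((i : ℕ) : ℂ) - ((j : ℕ) : ℂ) ≠ 0 := by
      rw [sub_ne_zero]
      exact fun h => hij (Fin.ext (by exact_mod_cast h))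
    by_cases he : J.eig i = J.eig j
    · filter_upwards [self_mem_nhdsWithin] with s hs _ h
      simp only [eig, he, add_right_inj] at h
      have : s * ((i : ℕ) - (j : ℕ) : ℂ) = 0 := by linear_combination h
      exact (mul_ne_zero hs hd) this
    · apply Filter.Eventually.filter_mono nhdsWithin_le_nhds
      have hc : Continuous fun s => eig s i - eig s j := by simp only [eig]; fun_prop
      have := hc.continuousAt.eventually_ne (x := 0) (y := 0) (by
        simpa [eig, sub_ne_zero] using he)
      filter_upwards [this] with s hs _
      exact sub_ne_zero.mp hs
  obtain ⟨s, hs1, hs2⟩ := (h1.and h2).exists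
  refine ⟨B s, hs1, ?_⟩
  let J' : JordanForm (B s) := ⟨J.r, J.size, J.size_pos, eig s, J.e, J.P, rfl⟩
  rw [J'.isDerogatory_iff, not_not]
  intro i j h
  by_contra hij
  exact hs2 i j hij h

/-! ### Gluing two Jordan chains -/

namespace JordanForm

/-- The matrix that maps the first vector of the Jordan chain `b` to the last vector of the chain
`a`, and all other vectors of the Jordan basis to zero. -/
def link (J : JordanForm A) (a b : Fin J.r) : Matrix (Fin n) (Fin n) ℂ :=
  LinearMap.toMatrix' (((LinearMap.proj (J.bot b)).comp J.coords.toLinearMap).smulRight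
    (J.coords.symm (Pi.single (J.top a) 1)))

theorem link_mulVec (J : JordanForm A) (a b : Fin J.r) (u : Fin n → ℂ) :
    (J.link a b).mulVec u = J.coords u (J.bot b) • J.coords.symm (Pi.single (J.top a) 1) := by
  rw [link, ← Matrix.toLin'_apply, Matrix.toLin'_toMatrix']
  rfl

theorem coords_eq_of_link (J : JordanForm A) {a b : Fin J.r} {t μ : ℂ} {u : Fin n → ℂ}
    (hu : (A + t • J.link a b).mulVec u = μ • u) (s : Σ i : Fin J.r, Fin (J.size i)) :
    (J.eig s.1 - μ) * J.coords u s + nextEntry (J.coords u) s =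
      -(t * J.coords u (J.bot b) * (Pi.single (J.top a) 1 : _ → ℂ) s) := by
  have h := congrFun (congrArg J.coords hu) s
  rw [Matrix.add_mulVec, Matrix.smul_mulVec, link_mulVec, map_add, map_smul, map_smul, map_smul,
    LinearEquiv.apply_symm_apply] at h
  simp only [Pi.add_apply, Pi.smul_apply, smul_eq_mul, coords_mulVec] at h
  linear_combination h

/-- Linking two different chains creates no new eigenvalues. -/
theorem eig_of_link (J : JordanForm A) {a b : Fin J.r} (hab : a ≠ b) {t μ : ℂ}
    {u : Fin n → ℂ} (hu0 : u ≠ 0) (hu : (A + t • J.link a b).mulVec u = μ • u) :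
    ∃ i, J.eig i = μ := by
  by_contra! hμ
  -- Block `b` does not contain `top a`, so its equations are homogeneous. Once this coordinate
  -- vanishes, so does the link term, and all blocks become homogeneous.
  have hb : J.coords u (J.bot b) = 0 := by
    refine eq_zero_of_block (sub_ne_zero.mpr (hμ b)) (fun k => ?_) _
    rw [J.coords_eq_of_link hu ⟨b, k⟩, Pi.single_eq_of_ne, mul_zero, neg_zero]
    exact fun h => hab (congrArg Sigma.fst h).symm
  apply hu0
  rw [← J.coords.map_eq_zero_iff]
  ext ⟨i, k⟩
  refine eq_zero_of_block (sub_ne_zero.mpr (hμ i)) (fun k => ?_) k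
  rw [J.coords_eq_of_link hu ⟨i, k⟩, hb, mul_zero, zero_mul, neg_zero]

/-- Linking the chain `b` to the end of the chain `a` removes the first vector of `b` from the
eigenspace of the eigenvalue of `a`. -/
theorem coords_bot_of_link (J : JordanForm A) {a b : Fin J.r} {t : ℂ} (ht : t ≠ 0)
    {u : Fin n → ℂ} (hu : (A + t • J.link a b).mulVec u = J.eig a • u) :
    J.coords u (J.bot b) = 0 := by
  -- In this row both the diagonal term and the next entry vanish, leaving only the link term.
  have h := J.coords_eq_of_link hu (J.top a)
  have h1 : nextEntry (J.coords u) (J.top a) = 0 := by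
    have := J.size_pos a
    rw [nextEntry, dif_neg]
    simp only [top]
    omega
  rw [h1, Pi.single_eq_same] at h
  simp only [top, sub_self, zero_mul, add_zero, mul_one] at h
  exact (mul_eq_zero.mp (neg_eq_zero.mp h.symm)).resolve_left ht

end JordanForm

/-! ### Eigenvectors of triangular matrices -/

/-- Every diagonal entry of an upper triangular matrix is an eigenvalue, with an eigenvector that
vanishes below that entry. -/
theorem exists_eigenvector_of_blockTriangular {T : Matrix (Fin n) (Fin n) ℂ}
    (hT : T.BlockTriangular id) (p : Fin n) :
    ∃ y : Fin n → ℂ, ‖y‖ = 1 ∧ (∀ i, p < i → y i = 0) ∧ T.mulVec y = T p p • y := by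
  -- The zero at position `p` of the diagonal makes `T'` singular, and its identity rows force
  -- kernel vectors to vanish after `p`.
  let T' : Matrix (Fin n) (Fin n) ℂ := Matrix.of fun i j =>
    if i ≤ p then (T - T p p • (1 : Matrix (Fin n) (Fin n) ℂ)) i j
      else (1 : Matrix (Fin n) (Fin n) ℂ) i j
  have hS : (T - T p p • (1 : Matrix (Fin n) (Fin n) ℂ)).BlockTriangular id := by
    intro i j hij
    rw [Matrix.sub_apply, Matrix.smul_apply, hT hij, Matrix.one_apply_ne (show i ≠ j from hij.ne'), smul_zero,
      sub_zero]
  have hT' : T'.BlockTriangular id := by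
    intro i j hij
    simp only [T', Matrix.of_apply]
    split_ifs
    · exact hS hij
    · exact Matrix.one_apply_ne hij.ne'
  have hdet : T'.det = 0 := by
    rw [Matrix.det_of_isUpperTriangular hT']
    exact Finset.prod_eq_zero (Finset.mem_univ p) (by simp [T'])
  obtain ⟨y, hy0, hy⟩ := Matrix.exists_mulVec_eq_zero_iff.mpr hdet
  have hrow : ∀ i, ¬ i ≤ p → y i = 0 := by
    intro i hi
    have := congrFun hy i
    simp only [Matrix.mulVec, T', Matrix.of_apply, if_neg hi] at this
    simpa [dotProduct, Matrix.one_apply] using this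
  have heig : T.mulVec y = T p p • y := by
    ext i
    by_cases hi : i ≤ p
    · have := congrFun hy i
      simp only [Matrix.mulVec, T', Matrix.of_apply, if_pos hi] at this
      have h2 : (T - T p p • (1 : Matrix (Fin n) (Fin n) ℂ)).mulVec y i = 0 := this
      rw [Matrix.sub_mulVec, Matrix.smul_mulVec, Matrix.one_mulVec] at h2
      simpa [sub_eq_zero] using h2
    · rw [Pi.smul_apply, hrow i hi, smul_zero]
      rw [Matrix.mulVec, dotProduct]
      refine Finset.sum_eq_zero fun j _ => ?_
      by_cases hj : j ≤ p
      · rw [hT (show id j < id i from lt_of_le_of_lt hj (not_le.mp hi)), zero_mul]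
      · rw [hrow j hj, mul_zero]
  have hn : ‖y‖ ≠ 0 := norm_ne_zero_iff.mpr hy0
  refine ⟨((‖y‖⁻¹ : ℝ) : ℂ) • y, ?_, fun i hi => ?_, ?_⟩
  · rw [norm_smul, Complex.norm_real, norm_inv, norm_norm, inv_mul_cancel₀ hn]
  · rw [Pi.smul_apply, hrow i (not_le.mpr hi), smul_zero]
  · rw [Matrix.mulVec_smul, heig, smul_comm]

theorem IsSchurDecomposition.mulVec_mulVec {U T : Matrix (Fin n) (Fin n) ℂ}
    (h : IsSchurDecomposition A U T) (y : Fin n → ℂ) :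
    A.mulVec (U.mulVec y) = U.mulVec (T.mulVec y) := by
  have h1 : U.conjTranspose * U = 1 := Matrix.mem_unitaryGroup_iff'.mp h.1
  rw [Matrix.mulVec_mulVec, Matrix.mulVec_mulVec]
  conv_lhs => rw [h.2.2]
  rw [Matrix.mul_assoc, h1, Matrix.mul_one]

theorem IsSchurDecomposition.conjTranspose_mulVec {U T : Matrix (Fin n) (Fin n) ℂ}
    (h : IsSchurDecomposition A U T) (y : Fin n → ℂ) :
    U.conjTranspose.mulVec (U.mulVec y) = y := by
  have h1 : U.conjTranspose * U = 1 := Matrix.mem_unitaryGroup_iff'.mp h.1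
  rw [Matrix.mulVec_mulVec, h1, Matrix.one_mulVec]

/-- For an eigenvalue `c` of an upper triangular matrix there is an eigenvector whose last nonzero
entry is as early as possible, and it is unique up to scaling. -/
theorem exists_shortest_eigenvector {T : Matrix (Fin n) (Fin n) ℂ} (hT : T.BlockTriangular id)
    {c : ℂ} {y : Fin n → ℂ} (hy0 : y ≠ 0) (hy : T.mulVec y = c • y) :
    ∃ (p : Fin n) (l : Fin n → ℂ), T p p = c ∧ l ≠ 0 ∧ T.mulVec l = c • l ∧
      ∀ z : Fin n → ℂ, (∀ i, p < i → z i = 0) → T.mulVec z = c • z → ∃ d : ℂ, z = d • l := by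
  classical
  let P : ℕ → Prop := fun q => ∃ l : Fin n → ℂ, l ≠ 0 ∧ T.mulVec l = c • l ∧
    ∀ i : Fin n, q ≤ (i : ℕ) → l i = 0
  have hP : ∃ q, P q := ⟨n, y, hy0, hy, fun i hi => absurd i.2 (not_lt.mpr hi)⟩
  have hmin := fun q => Nat.find_min hP (m := q)
  have hle : Nat.find hP ≤ n :=
    Nat.find_min' hP ⟨y, hy0, hy, fun i hi => absurd i.2 (not_lt.mpr hi)⟩
  obtain ⟨l, hl0, hl, hsupp⟩ := Nat.find_spec hP
  generalize Nat.find hP = q at *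
  obtain _ | m := q
  · exact absurd (funext fun i => hsupp i (Nat.zero_le _)) hl0
  let p : Fin n := ⟨m, hle⟩
  have hshort : ∀ z : Fin n → ℂ, (∀ i, p ≤ i → z i = 0) → T.mulVec z = c • z → z = 0 := by
    intro z hz hTz
    by_contra hz0
    exact hmin m (Nat.lt_succ_self m) ⟨z, hz0, hTz, fun i hi => hz i hi⟩
  have hsupp' : ∀ i, p < i → l i = 0 := fun i hi => hsupp i hi
  have hlp : l p ≠ 0 := fun h0 => hl0 (hshort l (fun i hi => by
    rcases hi.eq_or_lt with rfl | hi
    · exact h0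
    · exact hsupp' i hi) hl)
  refine ⟨p, l, ?_, hl0, hl, fun z hz hTz => ⟨z p / l p, ?_⟩⟩
  · have h1 := congrFun hl p
    rw [Matrix.mulVec, dotProduct, Finset.sum_eq_single p] at h1
    · exact mul_right_cancel₀ hlp h1
    · intro j _ hj
      rcases lt_or_gt_of_ne hj with h | h
      · rw [hT (show id j < id p from h), zero_mul]
      · rw [hsupp' j h, mul_zero]
    · simp
  -- The difference also vanishes at `p`, so it is too short to be a nonzero eigenvector.
  · rw [← sub_eq_zero]
    refine hshort _ (fun i hi => ?_) ?_
    · rcases hi.eq_or_lt with rfl | hi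
      · simp [div_mul_cancel₀ _ hlp]
      · simp [hz i hi, hsupp' i hi]
    · rw [Matrix.mulVec_sub, Matrix.mulVec_smul, hTz, hl]
      module

/-! ### Perturbations without a nearby Schur decomposition -/

/-- The matrices that have a Schur decomposition at distance at most `M` from `(U₀, T₀)`. -/
def schurBall (U₀ T₀ : Matrix (Fin n) (Fin n) ℂ) (M : ℝ) : Set (Matrix (Fin n) (Fin n) ℂ) :=
  {A | ∃ U T, IsSchurDecomposition A U T ∧ ‖U - U₀‖ + ‖T - T₀‖ ≤ M}

/-- The admissible pairs form a compact set, whose image under (U, T) ↦ U T U* is this one. -/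
theorem isClosed_schurBall (U₀ T₀ : Matrix (Fin n) (Fin n) ℂ) (M : ℝ) :
    IsClosed (schurBall U₀ T₀ M) := by
  let K : Set (Matrix (Fin n) (Fin n) ℂ × Matrix (Fin n) (Fin n) ℂ) :=
    {x | x.1 * star x.1 = 1 ∧ (∀ i j, j < i → x.2 i j = 0) ∧ ‖x.1 - U₀‖ + ‖x.2 - T₀‖ ≤ M}
  have hclosed : IsClosed K := by
    have h1 : Continuous fun x : Matrix (Fin n) (Fin n) ℂ × Matrix (Fin n) (Fin n) ℂ =>
        x.1 * star x.1 := by fun_prop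
    have h2 : ∀ i j, Continuous fun x : Matrix (Fin n) (Fin n) ℂ × Matrix (Fin n) (Fin n) ℂ =>
        x.2 i j := fun i j => by fun_prop
    have h3 : Continuous fun x : Matrix (Fin n) (Fin n) ℂ × Matrix (Fin n) (Fin n) ℂ =>
        ‖x.1 - U₀‖ + ‖x.2 - T₀‖ := by fun_prop
    have h4 : IsClosed {x : Matrix (Fin n) (Fin n) ℂ × Matrix (Fin n) (Fin n) ℂ |
        ∀ i j, j < i → x.2 i j = 0} := by
      simp only [Set.ofPred_forall]
      exact isClosed_iInter fun i => isClosed_iInter fun j => isClosed_iInter fun _ =>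
        isClosed_eq (h2 i j) continuous_const
    exact (isClosed_eq h1 continuous_const).inter (h4.inter (isClosed_le h3 continuous_const))
  have hbdd : K ⊆ Metric.closedBall U₀ M ×ˢ Metric.closedBall T₀ M := by
    rintro ⟨U, T⟩ ⟨-, -, h⟩
    simp only [Set.mem_prod, mem_closedBall_iff_norm]
    exact ⟨by linarith [norm_nonneg (T - T₀)], by linarith [norm_nonneg (U - U₀)]⟩
  have : ProperSpace (Matrix (Fin n) (Fin n) ℂ) := FiniteDimensional.proper ℂ _
  have hK : IsCompact K := ((isCompact_closedBall _ _).prod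
    (isCompact_closedBall _ _)).of_isClosed_subset hclosed hbdd
  have h := (hK.image (f := fun x : Matrix (Fin n) (Fin n) ℂ × Matrix (Fin n) (Fin n) ℂ =>
    x.1 * x.2 * x.1.conjTranspose) (by fun_prop)).isClosed
  convert h using 1
  ext A
  constructor
  · rintro ⟨U, T, ⟨hU, hT, hA⟩, hM⟩
    exact ⟨(U, T), ⟨Matrix.mem_unitaryGroup_iff.mp hU, fun i j hij => hT hij, hM⟩, hA.symm⟩
  · rintro ⟨⟨U, T⟩, ⟨hU, hT, hM⟩, hA⟩
    exact ⟨U, T, ⟨Matrix.mem_unitaryGroup_iff.mpr hU, fun i j hij => hT i j hij, hA.symm⟩, hM⟩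

/-- Close to a derogatory matrix there are matrices without a Schur decomposition close to the
given one. -/
theorem exists_notMem_schurBall {A₀ U₀ T₀ : Matrix (Fin n) (Fin n) ℂ}
    (h₀ : IsSchurDecomposition A₀ U₀ T₀) (hd : IsDerogatory A₀) :
    ∃ M > 0, ∀ ε > 0, ∃ A, ‖A - A₀‖ < ε ∧ A ∉ schurBall U₀ T₀ M := by
  obtain ⟨J⟩ := JordanForm.exists A₀
  have hinj := J.isDerogatory_iff.mp hd
  simp only [Function.Injective, not_forall] at hinj
  obtain ⟨i, j, hij, hne⟩ := hinj
  obtain ⟨c, hc⟩ : ∃ c, J.eig i = c := ⟨_, rfl⟩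
  obtain ⟨p, l, hp, hl0, hl, huniq⟩ : ∃ (p : Fin n) (l : Fin n → ℂ), T₀ p p = c ∧ l ≠ 0 ∧
      T₀.mulVec l = c • l ∧ ∀ z : Fin n → ℂ, (∀ i, p < i → z i = 0) → T₀.mulVec z = c • z →
        ∃ d : ℂ, z = d • l := by
    have hUU : U₀ * U₀.conjTranspose = 1 := Matrix.mem_unitaryGroup_iff.mp h₀.1
    have hy : U₀.mulVec (U₀.conjTranspose.mulVec (J.botVec i)) = J.botVec i := by
      rw [Matrix.mulVec_mulVec, hUU, Matrix.one_mulVec]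
    refine exists_shortest_eigenvector h₀.2.1
      (y := U₀.conjTranspose.mulVec (J.botVec i)) ?_ ?_
    · intro h0
      rw [h0, Matrix.mulVec_zero, eq_comm, JordanForm.botVec, LinearEquiv.map_eq_zero_iff] at hy
      have := congrFun hy (J.bot i)
      simp at this
    · rw [← h₀.conjTranspose_mulVec (T₀.mulVec _), ← h₀.mulVec_mulVec, hy, J.mulVec_botVec, hc,
        Matrix.mulVec_smul]
  have hUl : A₀.mulVec (U₀.mulVec l) = c • U₀.mulVec l := by
    rw [h₀.mulVec_mulVec, hl, Matrix.mulVec_smul]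
  have hUl0 : J.coords (U₀.mulVec l) ≠ 0 := by
    rw [ne_eq, LinearEquiv.map_eq_zero_iff]
    intro h0
    apply hl0
    rw [← h₀.conjTranspose_mulVec l, h0, Matrix.mulVec_zero]
  obtain ⟨s, hs⟩ := Function.ne_iff.mp hUl0
  obtain ⟨b, rfl⟩ : ∃ b, s = J.bot b := by
    refine ⟨s.1, (J.eq_bot_or s).resolve_right fun h => hs ?_⟩
    exact J.coords_eq_zero_of_eigenvector hUl s (Or.inr h)
  -- At least one of the two blocks `i`, `j` for `c` differs from `b`.
  obtain ⟨a, hab, ha⟩ : ∃ a, a ≠ b ∧ J.eig a = c := by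
    by_cases hib : i = b
    · exact ⟨j, fun h => hne (hib.trans h.symm), hij ▸ hc⟩
    · exact ⟨i, hib, hc⟩
  by_contra! hcon
  have hstep : ∀ M > 0, ∃ (U T : Matrix (Fin n) (Fin n) ℂ) (y : Fin n → ℂ),
      ‖U - U₀‖ + ‖T - T₀‖ ≤ M ∧ ‖y‖ = 1 ∧ (∀ i, p < i → y i = 0) ∧ T.mulVec y = T p p • y ∧
      (∃ i, J.eig i = T p p) ∧ (T p p = c → J.coords (U.mulVec y) (J.bot b) = 0) := by
    intro M hM
    obtain ⟨ε, hε, h⟩ := hcon M hM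
    obtain ⟨t, ht0, ht⟩ : ∃ t : ℂ, t ≠ 0 ∧ ‖(A₀ + t • J.link a b) - A₀‖ < ε := by
      have hcont : Continuous fun t : ℂ => ‖(A₀ + t • J.link a b) - A₀‖ := by fun_prop
      have h1 : ∀ᶠ t in 𝓝[≠] (0 : ℂ), ‖(A₀ + t • J.link a b) - A₀‖ < ε :=
        (hcont.continuousAt.eventually_lt continuousAt_const (by simpa using hε)).filter_mono
          nhdsWithin_le_nhds
      obtain ⟨t, h2, h3⟩ := (h1.and self_mem_nhdsWithin).exists
      exact ⟨t, h3, h2⟩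
    obtain ⟨U, T, hUT, hdist⟩ := h _ ht
    obtain ⟨y, hy1, hysupp, hy⟩ := exists_eigenvector_of_blockTriangular hUT.2.1 p
    have hUy : (A₀ + t • J.link a b).mulVec (U.mulVec y) = T p p • U.mulVec y := by
      rw [hUT.mulVec_mulVec, hy, Matrix.mulVec_smul]
    refine ⟨U, T, y, hdist, hy1, hysupp, hy, J.eig_of_link hab ?_ hUy, fun hTp => ?_⟩
    · intro h0
      have := hUT.conjTranspose_mulVec y
      rw [h0, Matrix.mulVec_zero] at this
      rw [← this, norm_zero] at hy1
      exact zero_ne_one hy1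
    · rw [hTp, ← ha] at hUy
      exact J.coords_bot_of_link ht0 hUy
  choose U T y hdist hy1 hysupp hy heig hzero using
    fun k : ℕ => hstep (1 / ((k : ℝ) + 1)) Nat.one_div_pos_of_nat
  have hU : Tendsto U atTop (𝓝 U₀) := by
    rw [tendsto_iff_norm_sub_tendsto_zero]
    exact squeeze_zero (fun _ => norm_nonneg _)
      (fun k => (le_add_of_nonneg_right (norm_nonneg _)).trans (hdist k))
      tendsto_one_div_add_atTop_nhds_zero_nat
  have hT : Tendsto T atTop (𝓝 T₀) := by
    rw [tendsto_iff_norm_sub_tendsto_zero]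
    exact squeeze_zero (fun _ => norm_nonneg _)
      (fun k => (le_add_of_nonneg_left (norm_nonneg _)).trans (hdist k))
      tendsto_one_div_add_atTop_nhds_zero_nat
  have hTp : Tendsto (fun k => T k p p) atTop (𝓝 c) := by
    rw [← hp]
    have : Continuous fun B : Matrix (Fin n) (Fin n) ℂ => B p p := by fun_prop
    exact (this.tendsto T₀).comp hT
  -- Convergence inside the finite set of eigenvalues of `A₀` makes these entries eventually
  -- constant.
  have hTc : ∀ᶠ k in atTop, T k p p = c := by
    have hfin : (Set.range J.eig \ {c}).Finite := (Set.finite_range _).subset Set.sdiff_subset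
    have h1 := hTp.eventually (hfin.isClosed.isOpen_compl.mem_nhds (by simp))
    filter_upwards [h1] with k hk
    by_contra hne
    exact hk ⟨heig k, hne⟩
  obtain ⟨z, hz, φ, hφ, hyz⟩ := (isCompact_sphere (0 : Fin n → ℂ) 1).tendsto_subseq
    (x := y) (fun k => by simpa using hy1 k)
  have hz1 : ‖z‖ = 1 := by simpa using hz
  have hUφ := hU.comp hφ.tendsto_atTop
  have hTφ := hT.comp hφ.tendsto_atTop
  have hmv : Continuous fun x : Matrix (Fin n) (Fin n) ℂ × (Fin n → ℂ) => x.1.mulVec x.2 := by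
    fun_prop
  have hzsupp : ∀ i, p < i → z i = 0 := by
    intro i hi
    have := ((continuous_apply i).tendsto z).comp hyz
    refine tendsto_nhds_unique this ?_
    simp only [Function.comp_def, hysupp _ i hi]
    exact tendsto_const_nhds
  have hTz : T₀.mulVec z = c • z := by
    have h1 := (hmv.tendsto (T₀, z)).comp (hTφ.prodMk_nhds hyz)
    have h2 := (hTp.comp hφ.tendsto_atTop).smul hyz
    refine tendsto_nhds_unique h1 (h2.congr fun k => ?_)
    exact (hy (φ k)).symm
  have hcz : J.coords (U₀.mulVec z) (J.bot b) = 0 := by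
    have hcc : Continuous J.coords := J.coords.toLinearMap.continuous_of_finiteDimensional
    have hcont : Continuous fun x : Matrix (Fin n) (Fin n) ℂ × (Fin n → ℂ) =>
        J.coords (x.1.mulVec x.2) (J.bot b) := (continuous_apply _).comp (hcc.comp hmv)
    have h1 := (hcont.tendsto (U₀, z)).comp (hUφ.prodMk_nhds hyz)
    refine tendsto_nhds_unique h1 (Tendsto.congr' ?_ tendsto_const_nhds)
    filter_upwards [hφ.tendsto_atTop.eventually hTc] with k hk
    exact (hzero _ hk).symm
  -- The limit is `d • l`; as the `b`-coordinate of `U₀ l` is nonzero, `d = 0`, against `‖z‖ = 1`.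
  obtain ⟨d, rfl⟩ := huniq z hzsupp hTz
  rw [Matrix.mulVec_smul, map_smul, Pi.smul_apply, smul_eq_zero] at hcz
  rw [hcz.resolve_right hs, zero_smul, norm_zero] at hz1
  exact zero_ne_one hz1

/-- Passing to the infimum only gives a bound ≥ `M`; halving restores strictness. -/
theorem lt_iSup_schurDist {A₀ U₀ T₀ A : Matrix (Fin n) (Fin n) ℂ} {ε M : ℝ} (hM : 0 < M)
    (hA : A ∈ differentGK A₀ ε) (h : A ∉ schurBall U₀ T₀ M) :
    ENNReal.ofReal (M / 2) < ⨆ A ∈ differentGK A₀ ε, schurDist U₀ T₀ A := by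
  have h1 : ENNReal.ofReal M ≤ schurDist U₀ T₀ A := by
    refine le_iInf fun U => le_iInf fun T => le_iInf fun hUT => ENNReal.ofReal_le_ofReal ?_
    by_contra! hlt
    exact h ⟨U, T, hUT, hlt.le⟩
  calc ENNReal.ofReal (M / 2) < ENNReal.ofReal M :=
        (ENNReal.ofReal_lt_ofReal_iff hM).mpr (half_lt_self hM)
    _ ≤ schurDist U₀ T₀ A := h1
    _ ≤ _ := le_iSup₂ (f := fun A _ => schurDist U₀ T₀ A) A hA

/-- Matrices with a Schur decomposition close to that of `A₀` are close to `A₀`. -/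
theorem exists_schurBall_subset {A₀ U₀ T₀ : Matrix (Fin n) (Fin n) ℂ}
    (h₀ : IsSchurDecomposition A₀ U₀ T₀) {ε : ℝ} (hε : 0 < ε) :
    ∃ M > 0, ∀ A ∈ schurBall U₀ T₀ M, ‖A - A₀‖ < ε := by
  have hcont : Continuous fun x : Matrix (Fin n) (Fin n) ℂ × Matrix (Fin n) (Fin n) ℂ =>
      ‖x.1 * x.2 * x.1.conjTranspose - A₀‖ := by fun_prop
  have h1 := (hcont.continuousAt (x := (U₀, T₀))).eventually_lt continuousAt_const
    (g := fun _ => ε) (by simpa [← h₀.2.2] using hε)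
  obtain ⟨δ, hδ, h⟩ := Metric.eventually_nhds_iff.mp h1
  refine ⟨δ / 2, half_pos hδ, ?_⟩
  rintro _ ⟨U, T, ⟨-, -, rfl⟩, hd⟩
  refine h (y := (U, T)) ?_
  rw [Prod.dist_eq, dist_eq_norm, dist_eq_norm]
  have := norm_nonneg (U - U₀)
  have := norm_nonneg (T - T₀)
  exact max_lt (by linarith) (by linarith)

theorem eventually_not_isDerogatory {A₀ : Matrix (Fin n) (Fin n) ℂ} (h : ¬ IsDerogatory A₀) :
    ∃ ε > 0, ∀ A, ‖A - A₀‖ < ε → ¬ IsDerogatory A := by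
  obtain ⟨ε, hε, hball⟩ := Metric.isOpen_iff.mp
    (isClosed_isDerogatory (n := n)).isOpen_compl A₀ h
  exact ⟨ε, hε, fun A hA => hball (mem_ball_iff_norm.mpr hA)⟩

/-- Near a derogatory matrix there are matrices with other Gohberg–Kaashoek numbers and no Schur
decomposition close to the given one. -/
theorem exists_mem_differentGK_notMem_schurBall {A₀ U₀ T₀ : Matrix (Fin n) (Fin n) ℂ}
    (h₀ : IsSchurDecomposition A₀ U₀ T₀) (hd : IsDerogatory A₀) :
    ∃ M > 0, ∀ ε > 0, ∃ A ∈ differentGK A₀ ε, A ∉ schurBall U₀ T₀ M := by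
  obtain ⟨M, hM, h⟩ := exists_notMem_schurBall h₀ hd
  refine ⟨M, hM, fun ε hε => ?_⟩
  obtain ⟨A, hA, hAM⟩ := h ε hε
  -- Both properties of `A` survive a small move, which density uses to reach a non-derogatory `B`.
  have hopen : IsOpen (Metric.ball A₀ ε ∩ (schurBall U₀ T₀ M)ᶜ) :=
    Metric.isOpen_ball.inter (isClosed_schurBall U₀ T₀ M).isOpen_compl
  obtain ⟨δ, hδ, hball⟩ := Metric.isOpen_iff.mp hopen A ⟨mem_ball_iff_norm.mpr hA, hAM⟩
  obtain ⟨B, hB, hBd⟩ := exists_not_isDerogatory A hδ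
  obtain ⟨h1, h2⟩ := hball (mem_ball_iff_norm.mpr hB)
  exact ⟨B, ⟨mem_ball_iff_norm.mp h1, gkNumbers_ne hd hBd⟩, h2⟩

/-- The bound tends to 0 with ‖A - A₀‖, the exponent being positive because `n ≠ 0`. -/
theorem ForwardStable.exists_ball_subset {A₀ U₀ T₀ : Matrix (Fin n) (Fin n) ℂ} (hn : n ≠ 0)
    (h : ForwardStable A₀ U₀ T₀) {M : ℝ} (hM : 0 < M) :
    ∃ ε > 0, ∀ A, ‖A - A₀‖ < ε → A ∈ schurBall U₀ T₀ M := by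
  obtain ⟨K, -, ε, hε, h⟩ := h
  have hn' : 0 < 1 / (n : ℝ) := by positivity
  have hcont : Continuous fun x : ℝ => K * x ^ (1 / (n : ℝ)) :=
    continuous_const.mul (Real.continuous_rpow_const hn'.le)
  have h1 := (hcont.continuousAt (x := 0)).eventually_lt continuousAt_const (g := fun _ => M)
    (by rwa [Real.zero_rpow hn'.ne', mul_zero])
  obtain ⟨δ, hδ, hδM⟩ := Metric.eventually_nhds_iff.mp h1
  refine ⟨min ε δ, lt_min hε hδ, fun A hA => ?_⟩
  obtain ⟨U, T, hUT, hle⟩ := h A (hA.trans_le (min_le_left _ _))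
  refine ⟨U, T, hUT, hle.trans (hδM ?_).le⟩
  rw [dist_zero_right, norm_norm]
  exact hA.trans_le (min_le_right _ _)

end SchurStability
end

theorem theorem1p6 {n : ℕ} (A₀ U₀ T₀ : Matrix (Fin n) (Fin n) ℂ)
    (h₀ : SchurStability.IsSchurDecomposition A₀ U₀ T₀) :
    ∃ M : ℝ, 0 < M ∧
      (∀ ε : ℝ, 0 < ε → (SchurStability.differentGK A₀ ε).Nonempty →
        ENNReal.ofReal M <
          ⨆ A ∈ SchurStability.differentGK A₀ ε, SchurStability.schurDist U₀ T₀ A) ∧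
      (SchurStability.IsDerogatory A₀ →
        (∀ ε : ℝ, 0 < ε → (SchurStability.differentGK A₀ ε).Nonempty) ∧
        ¬ SchurStability.ForwardStable A₀ U₀ T₀) := by
  open SchurStability in
  by_cases hd : IsDerogatory A₀
  · obtain ⟨M, hM, h⟩ := exists_mem_differentGK_notMem_schurBall h₀ hd
    refine ⟨M / 2, half_pos hM, fun ε hε _ => ?_, fun _ => ⟨fun ε hε => ?_, fun hs => ?_⟩⟩
    · obtain ⟨A, hA, hAM⟩ := h ε hε
      exact lt_iSup_schurDist hM hA hAM
    · obtain ⟨A, hA, -⟩ := h ε hε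
      exact ⟨A, hA⟩
    · obtain ⟨ε, hε, hball⟩ := hs.exists_ball_subset (by have := hd.one_lt; omega) hM
      obtain ⟨A, hA, hAM⟩ := h ε hε
      exact hAM (hball A hA.1)
  · obtain ⟨ε₀, hε₀, hball⟩ := eventually_not_isDerogatory hd
    obtain ⟨M, hM, hsub⟩ := exists_schurBall_subset h₀ hε₀
    refine ⟨M / 2, half_pos hM, ?_, fun h => absurd h hd⟩
    rintro ε - ⟨A, hA⟩
    -- A nearby Schur decomposition would put `A` in the non-derogatory neighbourhood of `A₀`, where
    -- the numbers are constant; this works for every `ε`.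
    refine lt_iSup_schurDist hM hA fun hAM => hA.2 ?_
    rw [gkNumbers_of_not_isDerogatory (hball A (hsub A hAM)), gkNumbers_of_not_isDerogatory hd]
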